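/- Theorem 1.6. Let $1\le p<\infty$ and let $\{w_n\}_{n\in\mathbb Z}$ be a bounded sequence of nonzero complex numbers. Let $T$ be the bilateral weighted shift on the complex Banach space $\ell_p(\mathbb Z)$ with weights $w_n$, that is, the bounded linear operator with $Te_n=w_ne_{n-1}$ for all $n\in\mathbb Z$, where $\{e_n\}_{n\in\mathbb Z}$ is the canonical basis. Call $T$ hypercyclic (respectively weakly hypercyclic) if for some $x\in\ell_p(\mathbb Z)$ the orbit $\{T^nx : n=0,1,2,\dots\}$ is dense in the norm (respectively weak) topology, and supercyclic (respectively weakly supercyclic) if for some $x\in\ell_p(\mathbb Z)$ the projective orbit $\{\lambda T^nx : \lambda\in\mathbb C,\ n=0,1,2,\dots\}$ is dense in the norm (respectively weak) topology. (i) If $1\le p<2$ and $T$ is weakly hypercyclic, then $T$ is hypercyclic. (ii) If $1\le p\le 2$ and $T$ is weakly supercyclic, then $T$ is supercyclic. -/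

import Mathlib

open scoped ENNReal lp

section Cyclicity

variable {E : Type*} [NormedAddCommGroup E] [NormedSpace ℂ E]

/-- The orbit `{Tⁿ x : n = 0, 1, 2, …}`. -/
def forwardOrbit (T : E →L[ℂ] E) (x : E) : Set E :=
  {y | ∃ n : ℕ, y = (T ^ n) x}

/-- The projective orbit `{c Tⁿ x : n = 0, 1, 2, …, c ∈ ℂ}`. -/
def projectiveOrbit (T : E →L[ℂ] E) (x : E) : Set E :=
  {y | ∃ (n : ℕ) (c : ℂ), y = c • (T ^ n) x}

/-- Some orbit is dense in the norm topology. -/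
def IsHypercyclic (T : E →L[ℂ] E) : Prop :=
  ∃ x : E, Dense (forwardOrbit T x)

/-- Some projective orbit is dense in the norm topology. -/
def IsSupercyclic (T : E →L[ℂ] E) : Prop :=
  ∃ x : E, Dense (projectiveOrbit T x)

/-- Some orbit is dense in the weak topology. -/
def IsWeaklyHypercyclic (T : E →L[ℂ] E) : Prop :=
  ∃ x : E, Dense (toWeakSpace ℂ E '' forwardOrbit T x)

/-- Some projective orbit is dense in the weak topology. -/
def IsWeaklySupercyclic (T : E →L[ℂ] E) : Prop :=
  ∃ x : E, Dense (toWeakSpace ℂ E '' projectiveOrbit T x)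

end Cyclicity

/-- `T` is a bilateral weighted shift on `ℓ_p(ℤ)`: there is a bounded sequence `w` of nonzero
complex weights with `T eₙ = wₙ eₙ₋₁` for all `n ∈ ℤ`. Here `eₙ = lp.single p n 1` is the canonical
basis; for `p < ∞` its span is dense, so `w` determines the continuous linear operator `T`. -/
def IsBilateralWeightedShift {p : ℝ≥0∞} [Fact (1 ≤ p)]
    (T : ℓ^p(ℤ, ℂ) →L[ℂ] ℓ^p(ℤ, ℂ)) : Prop :=
  ∃ w : ℤ → ℂ, (∀ n, w n ≠ 0) ∧ (∃ C : ℝ, ∀ n, ‖w n‖ ≤ C) ∧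
    ∀ n : ℤ, T (lp.single p n (1 : ℂ)) = w n • lp.single p (n - 1) (1 : ℂ)

/-! ### Second-order smoothness of the `ℓ_q` power sum -/

/-- If `‖a‖ < ‖w‖`, every term is controlled by `‖w‖ ^ q`. Otherwise write `‖a + w‖ ^ 2 = A + X` and
split `(1 + t) ^ (q / 2)` as `(1 + t) * (1 + t) ^ (q / 2 - 1)`; Bernoulli's inequality for exponents
in `[0, 1]` bounds the second factor, which is where `q ≤ 4` enters. -/
theorem Complex.norm_add_rpow_le {q : ℝ} (hq2 : 2 ≤ q) (hq4 : q ≤ 4) (a w : ℂ) :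
    ‖a + w‖ ^ q ≤ ‖a‖ ^ q + q * ‖a‖ ^ (q - 2) * (starRingEnd ℂ a * w).re
      + 20 * (‖a‖ ^ (q - 2) * ‖w‖ ^ 2 + ‖w‖ ^ q) := by
  have hre : |(starRingEnd ℂ a * w).re| ≤ ‖a‖ * ‖w‖ := by
    refine (Complex.abs_re_le_norm _).trans ?_
    rw [norm_mul, RCLike.norm_conj]
  have hsq : ‖a + w‖ ^ 2 = ‖a‖ ^ 2 + (2 * (starRingEnd ℂ a * w).re + ‖w‖ ^ 2) := by
    rw [Complex.sq_norm, Complex.sq_norm, Complex.sq_norm, Complex.normSq_add]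
    have : (a * starRingEnd ℂ w).re = (starRingEnd ℂ a * w).re := by
      simp [Complex.mul_re]
    rw [this]; ring
  have hq : ∀ z : ℂ, ‖z‖ ^ q = (‖z‖ ^ 2) ^ (q / 2) := fun z => by
    rw [← Real.rpow_natCast, ← Real.rpow_mul (norm_nonneg _)]; congr 1; push_cast; ring
  have ha0 := norm_nonneg a
  have hw0 := norm_nonneg w
  rcases lt_or_ge ‖a‖ ‖w‖ with h | h
  · have hw : 0 < ‖w‖ := ha0.trans_lt h
    have h1 : ‖a + w‖ ^ q ≤ 16 * ‖w‖ ^ q := by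
      calc ‖a + w‖ ^ q ≤ (2 * ‖w‖) ^ q := by
            gcongr
            exact (norm_add_le _ _).trans (by linarith)
        _ = 2 ^ q * ‖w‖ ^ q := Real.mul_rpow (by norm_num) hw0
        _ ≤ 2 ^ (4 : ℝ) * ‖w‖ ^ q := by
            gcongr
            norm_num
        _ = _ := by norm_num
    have h2 : ‖a‖ ^ (q - 2) * (‖a‖ * ‖w‖) ≤ ‖w‖ ^ q := by
      calc ‖a‖ ^ (q - 2) * (‖a‖ * ‖w‖) ≤ ‖w‖ ^ (q - 2) * (‖w‖ * ‖w‖) := by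
            have : 0 ≤ q - 2 := by linarith
            gcongr
        _ = ‖w‖ ^ q := by
            rw [← sq, ← Real.rpow_natCast, ← Real.rpow_add hw]; congr 1; push_cast; ring
    have h3 : 0 ≤ ‖a‖ ^ (q - 2) := by positivity
    have h4 : -(‖a‖ * ‖w‖) ≤ (starRingEnd ℂ a * w).re := (abs_le.1 hre).1
    have h5 : -(4 * ‖w‖ ^ q) ≤ q * ‖a‖ ^ (q - 2) * (starRingEnd ℂ a * w).re := by
      have : ‖a‖ ^ (q - 2) * -(‖a‖ * ‖w‖) ≤ ‖a‖ ^ (q - 2) * (starRingEnd ℂ a * w).re := by gcongr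
      have h6 : -‖w‖ ^ q ≤ ‖a‖ ^ (q - 2) * (starRingEnd ℂ a * w).re := by linarith
      have h7 : 0 ≤ ‖w‖ ^ q := by positivity
      nlinarith
    have h6 : 0 ≤ ‖a‖ ^ q := by positivity
    have h7 : 0 ≤ ‖a‖ ^ (q - 2) * ‖w‖ ^ 2 := by positivity
    have h8 : 0 ≤ ‖w‖ ^ q := by positivity
    linarith
  · rcases ha0.eq_or_lt with ha | ha
    · have : w = 0 := norm_le_zero_iff.1 (by rw [ha]; exact h)
      have ha' : a = 0 := norm_eq_zero.1 ha.symm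
      subst this ha'
      simp [Real.zero_rpow (show q ≠ 0 by linarith)]
    · set A := ‖a‖ ^ 2 with hA
      have hA0 : 0 < A := by positivity
      set R := (starRingEnd ℂ a * w).re
      set X := 2 * R + ‖w‖ ^ 2 with hX
      have hAX : 0 ≤ A + X := by rw [← hsq]; positivity
      have hXA : -1 ≤ X / A := by rw [le_div_iff₀ hA0]; linarith
      have hB : (1 + X / A) ^ (q / 2) ≤ (1 + X / A) * (1 + (q / 2 - 1) * (X / A)) := by
        rcases hXA.eq_or_lt with h0 | h0
        · rw [← h0]; simp [Real.zero_rpow (show q / 2 ≠ 0 by linarith)]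
        · have hpos : 0 < 1 + X / A := by linarith
          calc (1 + X / A) ^ (q / 2) = (1 + X / A) * (1 + X / A) ^ (q / 2 - 1) := by
                rw [← Real.rpow_one_add' hpos.le (by linarith)]; congr 1; ring
            _ ≤ _ := by
                gcongr
                exact rpow_one_add_le_one_add_mul_self hXA (by linarith) (by linarith)
      have hpow : ‖a + w‖ ^ q = A ^ (q / 2) * (1 + X / A) ^ (q / 2) := by
        rw [hq, hsq, ← Real.mul_rpow hA0.le (by linarith)]
        congr 1; field_simp
      have hAq : A ^ (q / 2) = ‖a‖ ^ q := (hq a).symm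
      have hsplit : ‖a‖ ^ q = ‖a‖ ^ (q - 2) * A := by
        rw [hA, ← Real.rpow_natCast, ← Real.rpow_add ha]; congr 1; push_cast; ring
      have hX2 : X ^ 2 ≤ 9 * (A * ‖w‖ ^ 2) := by
        have h1 : |X| ≤ 3 * (‖a‖ * ‖w‖) := by
          rw [hX]
          refine (abs_add_le _ _).trans ?_
          rw [abs_mul, abs_of_nonneg (sq_nonneg ‖w‖)]
          norm_num
          nlinarith
        have := sq_le_sq' (abs_le.1 h1).1 (abs_le.1 h1).2
        calc X ^ 2 ≤ _ := this
          _ = _ := by rw [hA]; ring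
      rw [hpow, hAq]
      have hc : 0 ≤ ‖a‖ ^ (q - 2) := by positivity
      have key : ‖a‖ ^ q * ((1 + X / A) * (1 + (q / 2 - 1) * (X / A)))
          = ‖a‖ ^ q + ‖a‖ ^ (q - 2) * (q / 2 * X + (q / 2 - 1) * (X ^ 2 / A)) := by
        rw [hsplit]; field_simp; ring
      have hXA2 : X ^ 2 / A ≤ 9 * ‖w‖ ^ 2 := by
        rw [div_le_iff₀ hA0]; linarith
      have hXA0 : 0 ≤ X ^ 2 / A := by positivity
      calc ‖a‖ ^ q * (1 + X / A) ^ (q / 2)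
          ≤ ‖a‖ ^ q * ((1 + X / A) * (1 + (q / 2 - 1) * (X / A))) := by gcongr
        _ = _ := key
        _ ≤ ‖a‖ ^ q + ‖a‖ ^ (q - 2) * (q * R + 20 * ‖w‖ ^ 2) := by
            refine add_le_add_right (mul_le_mul_of_nonneg_left ?_ hc) _
            have : (q / 2 - 1) * (X ^ 2 / A) ≤ 1 * (9 * ‖w‖ ^ 2) := by
              gcongr; linarith
            have h2 : q / 2 * ‖w‖ ^ 2 ≤ 2 * ‖w‖ ^ 2 := by gcongr; linarith
            have h3 : q / 2 * X = q * R + q / 2 * ‖w‖ ^ 2 := by rw [hX]; ring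
            linarith [sq_nonneg ‖w‖]
        _ ≤ _ := by
            have : 0 ≤ ‖w‖ ^ q := by positivity
            linarith

theorem Complex.sum_norm_add_mul_rpow_le {κ : Type*} [Fintype κ] {q : ℝ} (hq2 : 2 ≤ q)
    (hq4 : q ≤ 4) {g h : κ → ℂ} (hg : ∑ k, ‖g k‖ ^ q ≤ 1) (hh : ∑ k, ‖h k‖ ^ q ≤ 1) :
    ∃ L : ℂ, ∀ s : ℂ, ‖s‖ ≤ 1 →
      ∑ k, ‖g k + s * h k‖ ^ q ≤ 1 + (s * L).re + 60 * ‖s‖ ^ 2 := by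
  refine ⟨∑ k, ((q * ‖g k‖ ^ (q - 2) : ℝ) : ℂ) * (starRingEnd ℂ (g k) * h k), fun s hs => ?_⟩
  have hsq : ‖s‖ ^ q ≤ ‖s‖ ^ 2 := by
    rw [← Real.rpow_natCast]
    exact Real.rpow_le_rpow_of_exponent_ge' (norm_nonneg _) hs (by norm_num) (by simpa using hq2)
  have hterm : ∀ k, ‖g k + s * h k‖ ^ q ≤ ‖g k‖ ^ q
      + (s * (((q * ‖g k‖ ^ (q - 2) : ℝ) : ℂ) * (starRingEnd ℂ (g k) * h k))).re
      + ‖s‖ ^ 2 * (20 * (‖g k‖ ^ q + 2 * ‖h k‖ ^ q)) := fun k => by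
    refine (Complex.norm_add_rpow_le hq2 hq4 (g k) (s * h k)).trans ?_
    have e : (s * (((q * ‖g k‖ ^ (q - 2) : ℝ) : ℂ) * (starRingEnd ℂ (g k) * h k))).re
        = q * ‖g k‖ ^ (q - 2) * (starRingEnd ℂ (g k) * (s * h k)).re := by
      rw [← Complex.re_ofReal_mul]; congr 1; ring
    rw [e, norm_mul, Real.mul_rpow (norm_nonneg _) (norm_nonneg _)]
    have h1 : ‖g k‖ ^ (q - 2) * ‖h k‖ ^ 2 ≤ ‖g k‖ ^ q + ‖h k‖ ^ q := by
      have hmax : ∀ x y : ℝ, 0 ≤ x → 0 ≤ y → x ≤ y → x ^ (q - 2) * y ^ 2 ≤ y ^ q ∧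
          y ^ (q - 2) * x ^ 2 ≤ y ^ q := by
        intro x y hx hy hxy
        have e : y ^ q = y ^ (q - 2) * y ^ 2 := by
          rcases hy.eq_or_lt with h0 | h0
          · rw [← h0]; simp [Real.zero_rpow (show q ≠ 0 by linarith)]
          · rw [← Real.rpow_natCast, ← Real.rpow_add h0]; congr 1; push_cast; ring
        have : 0 ≤ q - 2 := by linarith
        rw [e]
        constructor <;> gcongr
      have p1 : 0 ≤ ‖g k‖ ^ q := by positivity
      have p2 : 0 ≤ ‖h k‖ ^ q := by positivity
      rcases le_total ‖g k‖ ‖h k‖ with h | h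
      · linarith [(hmax _ _ (norm_nonneg _) (norm_nonneg _) h).1]
      · linarith [(hmax _ _ (norm_nonneg _) (norm_nonneg _) h).2]
    have h2 : ‖s‖ ^ q * ‖h k‖ ^ q ≤ ‖s‖ ^ 2 * ‖h k‖ ^ q := by gcongr
    have h3 : ‖s‖ ^ 2 * (‖g k‖ ^ (q - 2) * ‖h k‖ ^ 2) ≤ ‖s‖ ^ 2 * (‖g k‖ ^ q + ‖h k‖ ^ q) := by
      gcongr
    nlinarith
  calc ∑ k, ‖g k + s * h k‖ ^ q
      ≤ ∑ k, (‖g k‖ ^ q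
        + (s * (((q * ‖g k‖ ^ (q - 2) : ℝ) : ℂ) * (starRingEnd ℂ (g k) * h k))).re
        + ‖s‖ ^ 2 * (20 * (‖g k‖ ^ q + 2 * ‖h k‖ ^ q))) := Finset.sum_le_sum fun k _ => hterm k
    _ = ∑ k, ‖g k‖ ^ q + (s * ∑ k, ((q * ‖g k‖ ^ (q - 2) : ℝ) : ℂ) * (starRingEnd ℂ (g k) * h k)).re
        + ‖s‖ ^ 2 * (20 * (∑ k, ‖g k‖ ^ q + 2 * ∑ k, ‖h k‖ ^ q)) := by
        simp only [Finset.sum_add_distrib, Finset.mul_sum, Complex.re_sum, mul_add]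
    _ ≤ _ := by nlinarith [sq_nonneg ‖s‖]

/-! ### Circle averages -/

/-- Jensen's formula: for `b ≠ 0` the average is the maximum of `log ‖a‖` and `log (ρ * ‖b‖)`. -/
theorem Complex.le_circleAverage_log_norm_add_mul {a b : ℂ} {ρ : ℝ} (hρ : 0 < ρ) (ha : a ≠ 0)
    (hab : ∀ s : ℂ, ‖s‖ = ρ → a + s * b ≠ 0) :
    Real.log ‖a‖ ≤ Real.circleAverage (fun s => Real.log ‖a + s * b‖) 0 ρ ∧
      (b ≠ 0 → Real.log (ρ * ‖b‖) ≤ Real.circleAverage (fun s => Real.log ‖a + s * b‖) 0 ρ) := by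
  by_cases hb : b = 0
  · subst hb
    simp [Real.circleAverage_const]
  · have hb' : 0 < ‖b‖ := norm_pos_iff.2 hb
    have ha' : 0 < ‖a‖ := norm_pos_iff.2 ha
    have heq : Real.circleAverage (fun s => Real.log ‖a + s * b‖) 0 ρ
        = Real.log ‖b‖ + (Real.log ρ + Real.posLog (ρ⁻¹ * ‖0 - -(a / b)‖)) := by
      rw [← circleAverage_log_norm_sub_const_eq_log_radius_add_posLog hρ.ne']
      rw [← Real.circleAverage_const (Real.log ‖b‖) 0 ρ, ← Real.circleAverage_fun_add
        (circleIntegrable_const _ _ _) (circleIntegrable_log_norm_sub_const ρ)]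
      refine Real.circleAverage_congr_sphere fun s hs => ?_
      have hs' : ‖s‖ = ρ := by simpa [abs_of_pos hρ] using hs
      have hfac : a + s * b = b * (s - -(a / b)) := by field_simp; ring
      have hne := hab s hs'
      rw [hfac] at hne
      simp only [hfac, norm_mul]
      exact Real.log_mul hb'.ne' (norm_ne_zero_iff.2 (right_ne_zero_of_mul hne))
    rw [heq]
    refine ⟨?_, fun _ => ?_⟩
    · have h1 : Real.log (ρ⁻¹ * ‖0 - -(a / b)‖) ≤ Real.posLog (ρ⁻¹ * ‖0 - -(a / b)‖) :=
        le_max_right _ _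
      have h2 : Real.log (ρ⁻¹ * ‖0 - -(a / b)‖) = -Real.log ρ + (Real.log ‖a‖ - Real.log ‖b‖) := by
        rw [zero_sub, neg_neg, norm_div, Real.log_mul (by positivity) (by positivity), Real.log_inv,
          Real.log_div ha'.ne' hb'.ne']
      linarith
    · rw [Real.log_mul hρ.ne' hb'.ne']
      have : 0 ≤ Real.posLog (ρ⁻¹ * ‖0 - -(a / b)‖) := Real.posLog_nonneg
      linarith

theorem Complex.circleAverage_const_add_re_mul (A c : ℝ) (L : ℂ) (ρ : ℝ) :
    CircleIntegrable (fun s : ℂ => A + c * (s * L).re) 0 ρ ∧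
      Real.circleAverage (fun s : ℂ => A + c * (s * L).re) 0 ρ = A := by
  have hc : Continuous (fun s : ℂ => A + c * (s * L).re) := by fun_prop
  refine ⟨hc.continuousOn.circleIntegrable', ?_⟩
  have hd : DiffContOnCl ℂ (fun s : ℂ => (A : ℂ) + c * (s * L)) (Metric.ball 0 |ρ|) :=
    Differentiable.diffContOnCl (by fun_prop)
  have h1 := hd.circleAverage
  have hi : CircleIntegrable (fun s : ℂ => (A : ℂ) + c * (s * L)) 0 ρ :=
    (by fun_prop : Continuous (fun s : ℂ => (A : ℂ) + c * (s * L))).continuousOn.circleIntegrable'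
  have h2 := Complex.reCLM.circleAverage_comp_comm hi
  rw [h1] at h2
  convert h2 using 1
  · congr 1; ext s; simp
  · simp

/-! ### The plank theorem -/

/-- Take `g₀` maximising `∏ ‖l i g‖ ^ (b i ^ 2)` on the unit ball and perturb it by `s • h j` with
`‖s‖ = ρ`, `ρ` comparable to `b j`. On averaging over the circle, the linear term of the norm
vanishes, no factor's logarithm decreases, and factor `j` reaches at least `log (ρ * ‖l j (h j)‖)`.
Maximality limits this gain to a multiple of `b j ^ 2`. -/
theorem exists_plank_finite {κ ι : Type*} [Fintype κ] [Fintype ι] {q : ℝ} (hq2 : 2 ≤ q)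
    (hq4 : q ≤ 4) (l : ι → (κ → ℂ) →ₗ[ℂ] ℂ) (h : ι → κ → ℂ) (hh : ∀ i, ∑ k, ‖h i k‖ ^ q ≤ 1)
    (hl : ∀ i, l i (h i) ≠ 0) (b : ι → ℝ) (hb : ∀ i, 0 < b i) (hsum : ∑ i, b i ^ 2 ≤ 1) :
    ∃ g : κ → ℂ, ∑ k, ‖g k‖ ^ q ≤ 1 ∧
      ∀ i, Real.exp (-30) / 2 * (b i * ‖l i (h i)‖) ≤ ‖l i g‖ := by
  have hq0 : 0 < q := by linarith
  set N : (κ → ℂ) → ℝ := fun g => ∑ k, ‖g k‖ ^ q with hN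
  set F : (κ → ℂ) → ℝ := fun g => ∏ i, ‖l i g‖ ^ (b i ^ 2) with hF
  have hlc : ∀ i, Continuous (l i) := fun i => (l i).continuous_of_finiteDimensional
  have hNc : Continuous N := by
    refine continuous_finsetSum _ fun k _ => ?_
    exact (continuous_apply k).norm.rpow_const fun _ => Or.inr hq0.le
  have hFc : Continuous F := by
    refine continuous_finsetProd _ fun i _ => ?_
    exact (hlc i).norm.rpow_const fun _ => Or.inr (sq_nonneg _)
  have hcomp : IsCompact {g | N g ≤ 1} := by
    refine Metric.isCompact_of_isClosed_isBounded (isClosed_le hNc continuous_const) ?_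
    refine (Metric.isBounded_closedBall (x := (0 : κ → ℂ)) (r := 1)).subset fun g hg => ?_
    rw [mem_closedBall_zero_iff, pi_norm_le_iff_of_nonneg zero_le_one]
    intro k
    have h1 : ‖g k‖ ^ q ≤ 1 :=
      (Finset.single_le_sum (f := fun k => ‖g k‖ ^ q) (fun k _ => by positivity)
        (Finset.mem_univ k)).trans hg
    by_contra! hlt
    exact absurd h1 (not_le.2 (Real.one_lt_rpow hlt hq0))
  obtain ⟨g₀, hg₀, hmax⟩ := hcomp.exists_isMaxOn
    ⟨0, by simp [hN, Real.zero_rpow hq0.ne']⟩ hFc.continuousOn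
  refine ⟨g₀, hg₀, fun j => ?_⟩
  have hscale : ∀ g, (∀ i, l i g ≠ 0) → ∃ c : ℝ, 0 < c ∧ N ((c : ℂ) • g) ≤ 1 ∧
      Real.log c = -(Real.log (N g) / q) ∧ 0 < N g := fun g hg => by
    have hNg : 0 < N g := by
      obtain ⟨k, hk⟩ : ∃ k, g k ≠ 0 := by
        by_contra! h0
        exact hg j (by rw [show g = 0 from funext h0, map_zero])
      exact Finset.sum_pos' (fun k _ => by positivity)
        ⟨k, Finset.mem_univ k, Real.rpow_pos_of_pos (norm_pos_iff.2 hk) _⟩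
    refine ⟨N g ^ (-(1 / q)), by positivity, ?_, ?_, hNg⟩
    · have : N (((N g ^ (-(1 / q)) : ℝ) : ℂ) • g) = (N g ^ (-(1 / q))) ^ q * N g := by
        simp only [hN, Pi.smul_apply, smul_eq_mul, norm_mul, Finset.mul_sum]
        refine Finset.sum_congr rfl fun k _ => ?_
        rw [Real.mul_rpow (norm_nonneg _) (norm_nonneg _), Complex.norm_real,
          Real.norm_of_nonneg (by positivity)]
      rw [this, ← Real.rpow_mul hNg.le, show -(1 / q) * q = -1 by field_simp, Real.rpow_neg_one,
        inv_mul_cancel₀ hNg.ne']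
    · rw [Real.log_rpow hNg]; ring
  have hlogF : ∀ g, (∀ i, l i g ≠ 0) → Real.log (F g) = ∑ i, b i ^ 2 * Real.log ‖l i g‖ :=
    fun g hg => by
      rw [hF, Real.log_prod fun i _ => (Real.rpow_pos_of_pos (norm_pos_iff.2 (hg i)) _).ne']
      exact Finset.sum_congr rfl fun i _ => Real.log_rpow (norm_pos_iff.2 (hg i)) _
  have hFpos : ∀ g, (∀ i, l i g ≠ 0) → 0 < F g := fun g hg =>
    Finset.prod_pos fun i _ => Real.rpow_pos_of_pos (norm_pos_iff.2 (hg i)) _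
  have hsmul : ∀ (c : ℝ) g, 0 < c → (∀ i, l i g ≠ 0) → ∀ i, l i ((c : ℂ) • g) ≠ 0 :=
    fun c g hc hg i => by
      rw [map_smul, smul_eq_mul]
      exact mul_ne_zero (by exact_mod_cast hc.ne') (hg i)
  have hg₀l : ∀ i, l i g₀ ≠ 0 := by
    obtain ⟨g₁, hg₁⟩ := Module.Dual.exists_forall_ne_zero_of_forall_exists l fun i => ⟨h i, hl i⟩
    obtain ⟨c, hc, hc1, -⟩ := hscale g₁ hg₁
    have hpos : 0 < F g₀ := (hFpos _ (hsmul c g₁ hc hg₁)).trans_le (hmax hc1)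
    intro i h0
    refine hpos.ne' (Finset.prod_eq_zero (Finset.mem_univ i) ?_)
    rw [h0, norm_zero, Real.zero_rpow (pow_pos (hb i) 2).ne']
  -- Rescaling to the unit sphere turns constrained maximality into an inequality for every `g`
  -- outside the kernels.
  have hhom : ∀ g, (∀ i, l i g ≠ 0) → ∑ i, b i ^ 2 * Real.log ‖l i g‖
      ≤ ∑ i, b i ^ 2 * Real.log ‖l i g₀‖ + (∑ i, b i ^ 2) / q * Real.log (N g) := fun g hg => by
    obtain ⟨c, hc, hc1, hlc, -⟩ := hscale g hg
    have h1 := Real.log_le_log (hFpos _ (hsmul c g hc hg)) (hmax hc1)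
    rw [hlogF _ (hsmul c g hc hg), hlogF _ hg₀l] at h1
    have h2 : ∑ i, b i ^ 2 * Real.log ‖l i ((c : ℂ) • g)‖
        = ∑ i, b i ^ 2 * Real.log ‖l i g‖ + (∑ i, b i ^ 2) * Real.log c := by
      rw [Finset.sum_mul, ← Finset.sum_add_distrib]
      refine Finset.sum_congr rfl fun i _ => ?_
      rw [map_smul, smul_eq_mul, norm_mul, Complex.norm_real, Real.norm_of_nonneg hc.le,
        Real.log_mul hc.ne' (norm_ne_zero_iff.2 (hg i))]
      ring
    rw [h2, hlc] at h1
    have : (∑ i, b i ^ 2) * -(Real.log (N g) / q) = -((∑ i, b i ^ 2) / q * Real.log (N g)) := by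
      ring
    linarith
  have hbj := hb j
  have hbj1 : b j ≤ 1 := by
    have : b j ^ 2 ≤ 1 := (Finset.single_le_sum (f := fun i => b i ^ 2) (fun i _ => sq_nonneg _)
      (Finset.mem_univ j)).trans hsum
    nlinarith
  -- Avoiding finitely many radii keeps every `l i` nonzero on the circle. The lower bound `b j / 2`
  -- costs the factor `1 / 2` in the constant.
  obtain ⟨ρ, ⟨hρ1, hρ2⟩, hρ⟩ : ∃ ρ, ρ ∈ Set.Ioo (b j / 2) (b j) ∧
      ρ ∉ Set.range fun i => ‖l i g₀‖ / ‖l i (h j)‖ :=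
    ((Set.Ioo_infinite (by linarith)).sdiff (Set.finite_range _)).nonempty
  have hρ0 : 0 < ρ := by linarith
  have hne : ∀ i (s : ℂ), ‖s‖ = ρ → l i g₀ + s * l i (h j) ≠ 0 := fun i s hs h0 => by
    have h1 : ‖l i g₀‖ = ρ * ‖l i (h j)‖ := by
      rw [eq_neg_of_add_eq_zero_left h0, norm_neg, norm_mul, hs]
    have h2 : ‖l i (h j)‖ ≠ 0 := fun h2 => hg₀l i (by rw [← norm_eq_zero, h1, h2, mul_zero])
    exact hρ ⟨i, by simp only [h1]; field_simp⟩
  obtain ⟨L, hL⟩ := Complex.sum_norm_add_mul_rpow_le hq2 hq4 hg₀ (hh j)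
  set τ := ∑ i, b i ^ 2 with hτ
  have hτ0 : 0 ≤ τ := Finset.sum_nonneg fun i _ => sq_nonneg _
  set S := ∑ i, b i ^ 2 * Real.log ‖l i g₀‖ with hS
  have hint : ∀ i, CircleIntegrable (fun s => b i ^ 2 * Real.log ‖l i g₀ + s * l i (h j)‖) 0 ρ :=
    fun i => by
      refine ContinuousOn.circleIntegrable hρ0.le (ContinuousOn.mul continuousOn_const ?_)
      refine ContinuousOn.log (by fun_prop) fun s hs => ?_
      exact norm_ne_zero_iff.2 (hne i s (by simpa using hs))
  have havg : ∑ i, b i ^ 2 * Real.circleAverage (fun s => Real.log ‖l i g₀ + s * l i (h j)‖) 0 ρ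
      ≤ S + τ / q * (60 * ρ ^ 2) := by
    obtain ⟨hU1, hU2⟩ := Complex.circleAverage_const_add_re_mul (S + τ / q * (60 * ρ ^ 2)) (τ / q) L ρ
    rw [← hU2]
    have e : ∀ i, b i ^ 2 * Real.circleAverage (fun s => Real.log ‖l i g₀ + s * l i (h j)‖) 0 ρ
        = Real.circleAverage (fun s => b i ^ 2 * Real.log ‖l i g₀ + s * l i (h j)‖) 0 ρ :=
      fun i => (Real.circleAverage_fun_smul (a := b i ^ 2)
        (f := fun s => Real.log ‖l i g₀ + s * l i (h j)‖)).symm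
    rw [Finset.sum_congr rfl fun i _ => e i, ← Real.circleAverage_fun_sum fun i _ => hint i]
    refine Real.circleAverage_mono (CircleIntegrable.fun_sum _ fun i _ => hint i) hU1 fun s hs => ?_
    have hs' : ‖s‖ = ρ := by simpa [abs_of_pos hρ0] using hs
    have hl' : ∀ i, l i (g₀ + s • h j) = l i g₀ + s * l i (h j) := fun i => by simp
    have hg : ∀ i, l i (g₀ + s • h j) ≠ 0 := fun i => by rw [hl']; exact hne i s hs'
    have h1 := hhom _ hg
    simp only [hl'] at h1
    have h2 : Real.log (N (g₀ + s • h j)) ≤ (s * L).re + 60 * ρ ^ 2 := by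
      obtain ⟨-, -, -, -, hpos⟩ := hscale _ hg
      have h3 := Real.log_le_sub_one_of_pos hpos
      have h4 := hL s (by rw [hs']; linarith)
      rw [hs'] at h4
      have h5 : N (g₀ + s • h j) = ∑ k, ‖g₀ k + s * h j k‖ ^ q := by simp [hN]
      linarith
    have h3 : τ / q * Real.log (N (g₀ + s • h j)) ≤ τ / q * ((s * L).re + 60 * ρ ^ 2) := by
      gcongr
    linarith
  have hlow : S + b j ^ 2 * (Real.log (ρ * ‖l j (h j)‖) - Real.log ‖l j g₀‖)
      ≤ ∑ i, b i ^ 2 * Real.circleAverage (fun s => Real.log ‖l i g₀ + s * l i (h j)‖) 0 ρ := by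
    classical
    have e : S + b j ^ 2 * (Real.log (ρ * ‖l j (h j)‖) - Real.log ‖l j g₀‖)
        = ∑ i, b i ^ 2 * (if i = j then Real.log (ρ * ‖l j (h j)‖) else Real.log ‖l i g₀‖) := by
      have e' : ∀ i, b i ^ 2 * (if i = j then Real.log (ρ * ‖l j (h j)‖) else Real.log ‖l i g₀‖)
          = b i ^ 2 * Real.log ‖l i g₀‖ + if i = j then
            b j ^ 2 * (Real.log (ρ * ‖l j (h j)‖) - Real.log ‖l j g₀‖) else 0 := fun i => by
        split_ifs with hij
        · subst hij; ring
        · ring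
      rw [Finset.sum_congr rfl fun i _ => e' i, Finset.sum_add_distrib]
      simp [hS]
    rw [e]
    refine Finset.sum_le_sum fun i _ => mul_le_mul_of_nonneg_left ?_ (sq_nonneg _)
    obtain ⟨h1, h2⟩ := Complex.le_circleAverage_log_norm_add_mul hρ0 (hg₀l i) (hne i)
    split_ifs with hij
    · subst hij; exact h2 (hl i)
    · exact h1
  have hfin : Real.log (ρ * ‖l j (h j)‖) ≤ Real.log ‖l j g₀‖ + 30 := by
    have h1 : τ / q * (60 * ρ ^ 2) ≤ b j ^ 2 * 30 := by
      have h2 : τ / q ≤ 1 / 2 := by rw [div_le_div_iff₀ hq0 two_pos]; linarith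
      have h3 : ρ ^ 2 ≤ b j ^ 2 := by gcongr
      calc τ / q * (60 * ρ ^ 2) ≤ 1 / 2 * (60 * b j ^ 2) := by gcongr
        _ = _ := by ring
    have h4 : b j ^ 2 * (Real.log (ρ * ‖l j (h j)‖) - Real.log ‖l j g₀‖) ≤ b j ^ 2 * 30 := by
      linarith
    have := le_of_mul_le_mul_left h4 (by positivity)
    linarith
  have hlj : 0 < ‖l j (h j)‖ := norm_pos_iff.2 (hl j)
  have hgj : 0 < ‖l j g₀‖ := norm_pos_iff.2 (hg₀l j)
  have h5 : ρ * ‖l j (h j)‖ ≤ ‖l j g₀‖ * Real.exp 30 := by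
    rw [← Real.log_le_log_iff (by positivity) (by positivity), Real.log_mul hgj.ne'
      (Real.exp_ne_zero _), Real.log_exp]
    exact hfin
  calc Real.exp (-30) / 2 * (b j * ‖l j (h j)‖) = Real.exp (-30) * (b j / 2 * ‖l j (h j)‖) := by ring
    _ ≤ Real.exp (-30) * (ρ * ‖l j (h j)‖) := by gcongr
    _ ≤ Real.exp (-30) * (‖l j g₀‖ * Real.exp 30) := by gcongr
    _ = ‖l j g₀‖ := by
        rw [mul_comm, mul_assoc, ← Real.exp_add]; simp

theorem lp.sum_rpow_le_one {α : Type*} {p : ℝ≥0∞} [Fact (1 ≤ p)] {r : ℝ} (hr : 0 < r)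
    (hpr : p ≤ ENNReal.ofReal r) {x : ℓ^p(α, ℂ)} (hx : ‖x‖ ≤ 1) (G : Finset α) :
    ∑ k ∈ G, ‖x k‖ ^ r ≤ 1 := by
  have hp1 : 1 ≤ p := Fact.out
  have hptop : p ≠ ∞ := (hpr.trans_lt ENNReal.ofReal_lt_top).ne
  have hp0 : 0 < p.toReal := ENNReal.toReal_pos (zero_lt_one.trans_le hp1).ne' hptop
  have hpr' : p.toReal ≤ r := ENNReal.toReal_le_of_le_ofReal hr.le hpr
  calc ∑ k ∈ G, ‖x k‖ ^ r ≤ ∑ k ∈ G, ‖x k‖ ^ p.toReal := by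
        refine Finset.sum_le_sum fun k _ => ?_
        exact Real.rpow_le_rpow_of_exponent_ge' (norm_nonneg _)
          ((lp.norm_apply_le_norm (zero_lt_one.trans_le hp1).ne' x k).trans hx) hp0.le hpr'
    _ ≤ ‖x‖ ^ p.toReal := lp.sum_rpow_le_norm_rpow hp0 x G
    _ ≤ 1 := Real.rpow_le_one (norm_nonneg _) hx hp0.le

theorem lp.sum_smul_evalCLM_apply {α : Type*} {p : ℝ≥0∞} [Fact (1 ≤ p)] (G : Finset α)
    (g : α → ℂ) (x : ℓ^p(α, ℂ)) :
    (∑ k ∈ G, g k • lp.evalCLM ℂ (fun _ : α => ℂ) p k) x = ∑ k ∈ G, g k * x k := by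
  rw [sum_apply]
  rfl

theorem lp.norm_sum_smul_evalCLM_le {α : Type*} {p : ℝ≥0∞} [Fact (1 ≤ p)] {r q : ℝ}
    (hrq : r.HolderConjugate q) (hpr : p ≤ ENNReal.ofReal r) (G : Finset α) (g : α → ℂ)
    (hg : ∑ k ∈ G, ‖g k‖ ^ q ≤ 1) :
    ‖∑ k ∈ G, g k • lp.evalCLM ℂ (fun _ : α => ℂ) p k‖ ≤ 1 := by
  refine ContinuousLinearMap.opNorm_le_of_unit_norm zero_le_one fun x hx => ?_
  have h1 : ‖(∑ k ∈ G, g k • lp.evalCLM ℂ (fun _ : α => ℂ) p k) x‖ ≤ ∑ k ∈ G, ‖g k‖ * ‖x k‖ := by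
    rw [lp.sum_smul_evalCLM_apply]
    exact (norm_sum_le _ _).trans (Finset.sum_le_sum fun k _ => norm_mul_le _ _)
  refine h1.trans ?_
  have h2 := Real.inner_le_Lp_mul_Lq_of_nonneg G (f := fun k => ‖g k‖) (g := fun k => ‖x k‖)
    hrq.symm (fun k _ => norm_nonneg _) (fun k _ => norm_nonneg _)
  refine h2.trans (mul_le_one₀ ?_ (by positivity) ?_)
  · exact Real.rpow_le_one (by positivity) hg (one_div_nonneg.2 hrq.symm.pos.le)
  · exact Real.rpow_le_one (by positivity) (lp.sum_rpow_le_one hrq.pos hpr hx.le G)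
      (one_div_nonneg.2 hrq.pos.le)

/-- Only the coordinates in the union of the `F i` matter, and indices with zero weight or zero
pairing are trivial. Hölder, with the contractive inclusion of `ℓ_p` in `ℓ_r`, bounds the
functional. -/
theorem lp.exists_plank_finset {α ι : Type*} {p : ℝ≥0∞} [Fact (1 ≤ p)] {r q : ℝ}
    (hq2 : 2 ≤ q) (hq4 : q ≤ 4) (hrq : r.HolderConjugate q) (hpr : p ≤ ENNReal.ofReal r)
    (v : ι → ℓ^p(α, ℂ)) (F : ι → Finset α) (h : ι → α → ℂ)
    (hh : ∀ i, ∑ k ∈ F i, ‖h i k‖ ^ q ≤ 1) (b : ι → ℝ) (hb : ∀ i, 0 ≤ b i) (s : Finset ι)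
    (hs : ∑ i ∈ s, b i ^ 2 ≤ 1) :
    ∃ f : ℓ^p(α, ℂ) →L[ℂ] ℂ, ‖f‖ ≤ 1 ∧ ∀ i ∈ s,
      Real.exp (-30) / 2 * (b i * ‖∑ k ∈ F i, h i k * v i k‖) ≤ ‖f (v i)‖ := by
  classical
  have hq0 : q ≠ 0 := by linarith
  set G := s.biUnion F
  set s' := s.filter fun i => 0 < b i ∧ ∑ k ∈ F i, h i k * v i k ≠ 0 with hs'
  let l : s' → (G → ℂ) →ₗ[ℂ] ℂ := fun i => ∑ k : G, (v i k) • LinearMap.proj k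
  have hl : ∀ i g, l i g = ∑ k : G, v i k * g k := fun i g => by simp [l]
  let h' : s' → G → ℂ := fun i k => if (k : α) ∈ F i then h i k else 0
  have hFG : ∀ i ∈ s, F i ⊆ G := fun i hi => Finset.subset_biUnion_of_mem F hi
  have hs's : ∀ i : s', (i : ι) ∈ s := fun i => (Finset.mem_filter.1 i.2).1
  have hlh : ∀ i : s', l i (h' i) = ∑ k ∈ F i, h i k * v i k := fun i => by
    rw [hl]
    simp only [h']
    rw [Finset.sum_coe_sort G (fun k => v i k * if k ∈ F i then h i k else 0)]
    simp only [mul_ite, mul_zero]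
    rw [Finset.sum_ite_mem, Finset.inter_eq_right.2 (hFG i (hs's i))]
    exact Finset.sum_congr rfl fun k _ => mul_comm _ _
  obtain ⟨g, hg, hgl⟩ := exists_plank_finite hq2 hq4 l h' (fun i => by
      simp only [h']
      rw [Finset.sum_coe_sort G (fun k => ‖if k ∈ F i then h i k else 0‖ ^ q)]
      refine le_trans (le_of_eq ?_) (hh i)
      rw [← Finset.inter_eq_right.2 (hFG i (hs's i)), ← Finset.sum_ite_mem]
      refine Finset.sum_congr rfl fun k hk => ?_
      simp only [Finset.mem_inter, hk, true_and]
      split_ifs <;> simp [Real.zero_rpow hq0])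
    (fun i => by rw [hlh]; exact (Finset.mem_filter.1 i.2).2.2) (fun i => b i)
    (fun i => (Finset.mem_filter.1 i.2).2.1) (by
      rw [Finset.sum_coe_sort s' (fun i => b i ^ 2)]
      exact (Finset.sum_le_sum_of_subset_of_nonneg (Finset.filter_subset _ _)
        fun i _ _ => sq_nonneg _).trans hs)
  let g' : α → ℂ := fun k => if hk : k ∈ G then g ⟨k, hk⟩ else 0
  have hg' : ∀ k : G, g' k = g k := fun k => by simp [g']
  refine ⟨∑ k ∈ G, g' k • lp.evalCLM ℂ (fun _ : α => ℂ) p k,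
    lp.norm_sum_smul_evalCLM_le hrq hpr G g' ?_, fun i hi => ?_⟩
  · rw [← Finset.sum_coe_sort G]
    simpa only [hg'] using hg
  · by_cases hi' : i ∈ s'
    · have h1 := hgl ⟨i, hi'⟩
      rw [hlh] at h1
      refine h1.trans (le_of_eq ?_)
      congr 1
      rw [lp.sum_smul_evalCLM_apply, ← Finset.sum_coe_sort G, hl]
      exact Finset.sum_congr rfl fun k _ => by rw [hg', mul_comm]
    · have h0 : b i * ‖∑ k ∈ F i, h i k * v i k‖ = 0 := by
        simp only [hs', Finset.mem_filter, hi, true_and, not_and_or, not_not] at hi'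
        rcases hi' with h0 | h0
        · rw [le_antisymm (not_lt.1 h0) (hb i), zero_mul]
        · rw [h0]; simp
      rw [h0, mul_zero]
      exact norm_nonneg _

/-- A form of Ball's complex plank theorem in `ℓ_p`, up to a constant. -/
theorem lp.exists_plank {α ι : Type*} {p : ℝ≥0∞} [Fact (1 ≤ p)] {r q : ℝ}
    (hq2 : 2 ≤ q) (hq4 : q ≤ 4) (hrq : r.HolderConjugate q) (hpr : p ≤ ENNReal.ofReal r)
    (v : ι → ℓ^p(α, ℂ)) (F : ι → Finset α) (h : ι → α → ℂ)
    (hh : ∀ i, ∑ k ∈ F i, ‖h i k‖ ^ q ≤ 1) (b : ι → ℝ) (hb : ∀ i, 0 ≤ b i)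
    (hs : Summable fun i => b i ^ 2) :
    ∃ f : ℓ^p(α, ℂ) →L[ℂ] ℂ, ∃ c : ℝ, 0 < c ∧ ∀ i,
      c * (b i * ‖∑ k ∈ F i, h i k * v i k‖) ≤ ‖f (v i)‖ := by
  set B := 1 + ∑' i, b i ^ 2 with hB
  have hB0 : 0 < B := by have := tsum_nonneg (L := .unconditional ι) fun i => sq_nonneg (b i); linarith
  have hsB : 0 < √B := Real.sqrt_pos.2 hB0
  -- Each condition is weak-* closed, so Banach–Alaoglu passes from finite subfamilies to all
  -- indices.
  have hclosed : ∀ i, IsClosed {f : WeakDual ℂ ℓ^p(α, ℂ) |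
      Real.exp (-30) / 2 * (b i / √B * ‖∑ k ∈ F i, h i k * v i k‖) ≤ ‖f (v i)‖} := fun i =>
    isClosed_le continuous_const (WeakDual.eval_continuous (v i)).norm
  obtain ⟨f, -, hf⟩ := (WeakDual.isCompact_closedBall (0 : StrongDual ℂ ℓ^p(α, ℂ)) 1
    ).inter_iInter_nonempty _ hclosed fun u => by
      obtain ⟨f, hf1, hf⟩ := lp.exists_plank_finset hq2 hq4 hrq hpr v F h hh (fun i => b i / √B)
        (fun i => div_nonneg (hb i) hsB.le) u (by
          simp only [div_pow, Real.sq_sqrt hB0.le]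
          rw [← Finset.sum_div, div_le_one hB0]
          have := hs.sum_le_tsum u fun i _ => sq_nonneg (b i)
          linarith)
      refine ⟨StrongDual.toWeakDual f, ?_, ?_⟩
      · simpa using hf1
      · simp only [Set.mem_iInter]
        exact hf
  simp only [Set.mem_iInter] at hf
  refine ⟨WeakDual.toStrongDual f, Real.exp (-30) / 2 / √B, by positivity, fun i => ?_⟩
  refine le_trans (le_of_eq ?_) (hf i)
  ring

/-! ### Obstruction to weak density -/

theorem exists_mem_of_dense_toWeakSpace {E : Type*} [NormedAddCommGroup E] [NormedSpace ℂ E]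
    {S : Set E} (hS : Dense (toWeakSpace ℂ E '' S)) (φ f : E →L[ℂ] ℂ) {u : E} (hφ : φ u = 1)
    (hf : f u = 0) {δ : ℝ} (hδ : 0 < δ) : ∃ v ∈ S, ‖φ v - 1‖ < 1 / 2 ∧ ‖f v‖ < δ := by
  have hc : ∀ g : E →L[ℂ] ℂ, Continuous fun x : WeakSpace ℂ E => g ((toWeakSpace ℂ E).symm x) :=
    fun g => WeakBilin.eval_continuous (topDualPairing ℂ E).flip g
  have ho : IsOpen {x : WeakSpace ℂ E | ‖φ ((toWeakSpace ℂ E).symm x) - 1‖ < 1 / 2 ∧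
      ‖f ((toWeakSpace ℂ E).symm x)‖ < δ} :=
    (isOpen_lt ((hc φ).sub continuous_const).norm continuous_const).inter
      (isOpen_lt (hc f).norm continuous_const)
  obtain ⟨-, ⟨h1, h2⟩, v, hv, rfl⟩ := hS.inter_open_nonempty _ ho
    ⟨toWeakSpace ℂ E u, by simp [hφ], by simpa [hf] using hδ⟩
  exact ⟨v, hv, by simpa using h1, by simpa using h2⟩

/-- If every point of `S` whose coordinate `i` is near `1` is a multiple `c • v n` that is large
against the square-summable weights `b n`, then `S` is not weakly dense. -/
theorem lp.not_dense_of_plank {α : Type*} {p : ℝ≥0∞} [Fact (1 ≤ p)] {r q : ℝ}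
    (hq2 : 2 ≤ q) (hq4 : q ≤ 4) (hrq : r.HolderConjugate q) (hpr : p ≤ ENNReal.ofReal r)
    {i j : α} (hij : i ≠ j)
    (v : ℕ → ℓ^p(α, ℂ)) (F : ℕ → Finset α) (h : ℕ → α → ℂ)
    (hh : ∀ n, ∑ k ∈ F n, ‖h n k‖ ^ q ≤ 1) (b : ℕ → ℝ) (hb : ∀ n, 0 ≤ b n)
    (hs : Summable fun n => b n ^ 2) {S : Set ℓ^p(α, ℂ)} {ε : ℝ} (hε : 0 < ε)
    (hS : ∀ x ∈ S, ‖x i - 1‖ < 1 / 2 → ∃ (n : ℕ) (c : ℂ), x = c • v n ∧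
      ε ≤ ‖c‖ * (b n * ‖∑ k ∈ F n, h n k * v n k‖)) :
    ¬ Dense (toWeakSpace ℂ ℓ^p(α, ℂ) '' S) := by
  classical
  intro hd
  have hq0 : q ≠ 0 := by linarith
  obtain ⟨f, c, hc, hfj, hf⟩ : ∃ f : ℓ^p(α, ℂ) →L[ℂ] ℂ, ∃ c : ℝ, 0 < c ∧
      f (lp.single p j (1 : ℂ)) ≠ 0 ∧
      ∀ n, c * (b n * ‖∑ k ∈ F n, h n k * v n k‖) ≤ ‖f (v n)‖ := by
    -- The basis vector at `j` is prepended with weight `1`, to force `f` to be nonzero on it.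
    obtain ⟨f, c, hc, hf⟩ := lp.exists_plank hq2 hq4 hrq hpr
      (fun n : ℕ => n.casesOn (motive := fun _ => ℓ^p(α, ℂ)) (lp.single p j (1 : ℂ)) v)
      (fun n => n.casesOn (motive := fun _ => Finset α) {j} F)
      (fun n => n.casesOn (motive := fun _ => α → ℂ) (fun _ => 1) h)
      (by rintro (_ | n) <;> simp [hh])
      (fun n => n.casesOn (motive := fun _ => ℝ) 1 b)
      (by rintro (_ | n) <;> simp [hb]) ((summable_nat_add_iff 1).1 hs)
    refine ⟨f, c, hc, ?_, fun n => hf (n + 1)⟩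
    have h1 : c * (1 * ‖∑ k ∈ {j}, 1 * (lp.single p j (1 : ℂ) : ℓ^p(α, ℂ)) k‖) ≤ ‖f (lp.single p j (1 : ℂ))‖ :=
      hf 0
    rw [Finset.sum_singleton, lp.single_apply_self, mul_one, norm_one, mul_one, mul_one] at h1
    exact norm_pos_iff.1 (hc.trans_le h1)
  -- The target `u` has coordinate `i` equal to `1` and is corrected along `j` so as to lie in the
  -- kernel of `f`.
  obtain ⟨x, hxS, hx1, hx2⟩ := exists_mem_of_dense_toWeakSpace hd
    (lp.evalCLM ℂ (fun _ : α => ℂ) p i) f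
    (u := lp.single p i (1 : ℂ) - (f (lp.single p i (1 : ℂ)) / f (lp.single p j (1 : ℂ))) •
      lp.single p j (1 : ℂ))
    (by
      change (lp.single p i (1 : ℂ) - _ : ℓ^p(α, ℂ)) i = 1
      rw [lp.coeFn_sub, lp.coeFn_smul, Pi.sub_apply, Pi.smul_apply, lp.single_apply_self,
        lp.single_apply_ne _ _ _ hij]
      simp)
    (by rw [map_sub, map_smul, smul_eq_mul, div_mul_cancel₀ _ hfj, sub_self])
    (mul_pos hc hε)
  obtain ⟨n, a, rfl, ha⟩ := hS x hxS hx1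
  rw [map_smul, norm_smul] at hx2
  have h2 := mul_le_mul_of_nonneg_left (hf n) (norm_nonneg a)
  have h3 := mul_le_mul_of_nonneg_left ha hc.le
  rw [mul_left_comm] at h3
  exact absurd hx2 (not_lt.2 (h3.trans h2))

/-! ### The shift in coordinates -/

theorem exists_int_partial_prod (w : ℤ → ℂ) (hw : ∀ n, w n ≠ 0) :
    ∃ b : ℤ → ℂ, (∀ k, b k ≠ 0) ∧ ∀ k, b (k + 1) = w (k + 1) * b k := by
  refine ⟨fun k => (∏ i ∈ Finset.range k.toNat, w (i + 1)) *
    (∏ i ∈ Finset.range (-k).toNat, w (-i))⁻¹, fun k => ?_, fun k => ?_⟩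
  · exact mul_ne_zero (Finset.prod_ne_zero_iff.2 fun i _ => hw _)
      (inv_ne_zero (Finset.prod_ne_zero_iff.2 fun i _ => hw _))
  · rcases lt_or_ge k 0 with hk | hk
    · obtain ⟨n, rfl⟩ : ∃ n : ℕ, k = -(n + 1 : ℕ) := ⟨(-k).toNat - 1, by omega⟩
      have h1 : (-(n + 1 : ℕ) + 1 : ℤ) = -(n : ℤ) := by push_cast; ring
      have h2 : (-(n : ℤ)).toNat = 0 := by omega
      have h3 : (-((n + 1 : ℕ) : ℤ)).toNat = 0 := by omega
      have h4 : (-(-((n + 1 : ℕ) : ℤ))).toNat = n + 1 := by omega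
      have h5 : (- -(n : ℤ)).toNat = n := by omega
      beta_reduce
      rw [h1, h2, h3, h4, h5, Finset.prod_range_succ, mul_inv]
      have := hw (-n)
      field_simp
    · have h1 : (k + 1).toNat = k.toNat + 1 := by omega
      have h2 : (-(k + 1)).toNat = 0 := by omega
      have h3 : (-k).toNat = 0 := by omega
      beta_reduce
      rw [h1, h2, h3, Finset.prod_range_succ, Int.toNat_of_nonneg hk]
      ring

/-- A bilateral weighted shift is the shift `x ↦ (b (k + 1) / b k * x (k + 1))`. -/
theorem IsBilateralWeightedShift.exists_weights {p : ℝ≥0∞} [Fact (1 ≤ p)] (hp : p ≠ ∞)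
    {T : ℓ^p(ℤ, ℂ) →L[ℂ] ℓ^p(ℤ, ℂ)} (hT : IsBilateralWeightedShift T) :
    ∃ (b : ℤ → ℂ) (M : ℝ), 1 ≤ M ∧ (∀ k, b k ≠ 0) ∧ (∀ k, ‖b (k + 1)‖ ≤ M * ‖b k‖) ∧
      ∀ (n : ℕ) (x : ℓ^p(ℤ, ℂ)) (k : ℤ), (T ^ n) x k = b (k + n) / b k * x (k + n) := by
  obtain ⟨w, hw, ⟨C, hC⟩, hTw⟩ := hT
  obtain ⟨b, hb, hbw⟩ := exists_int_partial_prod w hw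
  have hTx : ∀ (x : ℓ^p(ℤ, ℂ)) (k : ℤ), T x k = w (k + 1) * x (k + 1) := fun x k => by
    have h1 := ((lp.hasSum_single hp x).mapL T).mapL (lp.evalCLM ℂ (fun _ : ℤ => ℂ) p k)
    refine h1.unique ?_
    have h2 : ∀ i, lp.evalCLM ℂ (fun _ : ℤ => ℂ) p k (T (lp.single p i (x i)))
        = if i = k + 1 then w (k + 1) * x (k + 1) else 0 := fun i => by
      have h3 : lp.single p i (x i) = x i • (lp.single p i (1 : ℂ) : ℓ^p(ℤ, ℂ)) := by
        rw [← lp.single_smul, smul_eq_mul, mul_one]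
      rw [h3, map_smul, hTw]
      change x i • (w i • (lp.single p (i - 1) (1 : ℂ) : ℓ^p(ℤ, ℂ)) k) = _
      rw [lp.single_apply]
      by_cases hik : i = k + 1
      · subst hik; simp [mul_comm]
      · have : k ≠ i - 1 := by omega
        simp [hik, this]
    rw [funext h2]
    exact hasSum_ite_eq _ _
  refine ⟨b, max C 1, le_max_right _ _, hb, fun k => ?_, fun n => ?_⟩
  · rw [hbw, norm_mul]
    gcongr
    exact (hC _).trans (le_max_left _ _)
  · induction n with
    | zero => intro x k; simp [hb]
    | succ n ih =>
      intro x k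
      rw [pow_succ, mul_apply_eq_comp, ih, hTx]
      have h1 : k + ((n + 1 : ℕ) : ℤ) = k + n + 1 := by push_cast; ring
      rw [h1, hbw]
      ring

theorem norm_le_pow_mul_norm {b : ℤ → ℂ} {M : ℝ} (hM : 1 ≤ M)
    (hbM : ∀ k, ‖b (k + 1)‖ ≤ M * ‖b k‖) (k : ℤ) (n : ℕ) : ‖b (k + n)‖ ≤ M ^ n * ‖b k‖ := by
  induction n with
  | zero => simp
  | succ n ih =>
    have h1 : k + ((n + 1 : ℕ) : ℤ) = k + n + 1 := by push_cast; ring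
    rw [h1, pow_succ']
    refine (hbM _).trans ?_
    rw [mul_assoc]
    gcongr

theorem exists_coord_ne_zero {p : ℝ≥0∞} [Fact (1 ≤ p)] {T : ℓ^p(ℤ, ℂ) →L[ℂ] ℓ^p(ℤ, ℂ)}
    {b : ℤ → ℂ} (hT : ∀ (n : ℕ) (x : ℓ^p(ℤ, ℂ)) (k : ℤ), (T ^ n) x k = b (k + n) / b k * x (k + n))
    {x : ℓ^p(ℤ, ℂ)} (hx : Dense (toWeakSpace ℂ ℓ^p(ℤ, ℂ) '' projectiveOrbit T x)) (m : ℤ) :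
    ∃ l : ℕ, x (m + l) ≠ 0 := by
  by_contra! h0
  obtain ⟨y, ⟨n, c, rfl⟩, hy, -⟩ := exists_mem_of_dense_toWeakSpace hx
    (lp.evalCLM ℂ (fun _ : ℤ => ℂ) p m) 0 (u := lp.single p m (1 : ℂ))
    (lp.single_apply_self (E := fun _ : ℤ => ℂ) p m 1) rfl one_pos
  have h1 : lp.evalCLM ℂ (fun _ : ℤ => ℂ) p m (c • (T ^ n) x) = 0 := by
    change c • (T ^ n) x m = 0
    rw [hT, h0, mul_zero, smul_zero]
  rw [h1] at hy
  norm_num at hy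

theorem lp.summable_norm_sq {α : Type*} {p : ℝ≥0∞} (hp : p ≤ 2) (x : ℓ^p(α, ℂ)) :
    Summable fun k => ‖x k‖ ^ 2 := by
  have := ((lp.memℓp x).of_exponent_ge hp).summable (by norm_num)
  simpa using this

/-! ### Weak supercyclicity forces growth -/

theorem exists_growth_of_weaklySupercyclic {p : ℝ≥0∞} [Fact (1 ≤ p)] (hp2 : p ≤ 2)
    {T : ℓ^p(ℤ, ℂ) →L[ℂ] ℓ^p(ℤ, ℂ)} {b : ℤ → ℂ} {M : ℝ} (hM : 1 ≤ M) (hb : ∀ k, b k ≠ 0)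
    (hbM : ∀ k, ‖b (k + 1)‖ ≤ M * ‖b k‖)
    (hT : ∀ (n : ℕ) (x : ℓ^p(ℤ, ℂ)) (k : ℤ), (T ^ n) x k = b (k + n) / b k * x (k + n))
    (hws : IsWeaklySupercyclic T) (m₀ : ℤ) (K : ℝ) :
    ∃ n : ℕ, K ≤ ‖b (m₀ + n)‖ * ‖b (m₀ - n)‖ := by
  by_contra! hK
  obtain ⟨x, hx⟩ := hws
  obtain ⟨l, hl⟩ := exists_coord_ne_zero hT hx m₀
  -- Moving right, to a nonzero coordinate of `x`, costs only powers of `M` in the bound on the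
  -- product.
  set m := m₀ + l
  have hM0 : 0 < M := by linarith
  have hbpos : ∀ k, 0 < ‖b k‖ := fun k => norm_pos_iff.2 (hb k)
  set C := (M ^ l) ^ 2 * K
  have hC : ∀ n : ℕ, ‖b (m + n)‖ * ‖b (m - n)‖ ≤ C := fun n => by
    have h1 := norm_le_pow_mul_norm hM hbM (m₀ + n) l
    have h2 := norm_le_pow_mul_norm hM hbM (m₀ - n) l
    rw [show m₀ + (n : ℤ) + l = m + n by ring] at h1
    rw [show m₀ - (n : ℤ) + l = m - n by ring] at h2
    calc ‖b (m + n)‖ * ‖b (m - n)‖ ≤ (M ^ l * ‖b (m₀ + n)‖) * (M ^ l * ‖b (m₀ - n)‖) := by gcongr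
      _ = (M ^ l) ^ 2 * (‖b (m₀ + n)‖ * ‖b (m₀ - n)‖) := by ring
      _ ≤ C := by
          exact mul_le_mul_of_nonneg_left (hK n).le (by positivity)
  have hC0 : 0 < C := (mul_pos (hbpos _) (hbpos _)).trans_le (hC 0)
  have hxm : 0 < ‖x m‖ := norm_pos_iff.2 hl
  -- Coordinate `m - n` of `(T ^ n) x` is `b m / b (m - n) * x m`. Since the product is bounded,
  -- this is at least a multiple of `‖b (m + n)‖`; multiplied by the weight `‖x (m + n)‖`, it
  -- recovers the size of coordinate `m`.
  refine lp.not_dense_of_plank (p := p) (r := 2) (q := 2) le_rfl (by norm_num)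
    Real.HolderConjugate.two_two (by simpa using hp2) (i := m) (j := m + 1) (by omega)
    (fun n => (T ^ n) x) (fun n => {m - n}) (fun _ _ => 1) (by simp) (fun n => ‖x (m + n)‖)
    (fun n => norm_nonneg _)
    ((lp.summable_norm_sq hp2 x).comp_injective (i := fun n : ℕ => m + n) fun a c h => by simpa using h)
    (ε := 1 / 2 * ‖b m‖ ^ 2 * ‖x m‖ / C) (by have := hbpos m; positivity) ?_ hx
  rintro _ ⟨n, c, rfl⟩ hy
  refine ⟨n, c, rfl, ?_⟩
  have e1 : (c • (T ^ n) x : ℓ^p(ℤ, ℂ)) m = c * (b (m + n) / b m * x (m + n)) := by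
    rw [← hT]; rfl
  have h1 : 1 / 2 ≤ ‖c‖ * (‖b (m + n)‖ / ‖b m‖ * ‖x (m + n)‖) := by
    rw [e1] at hy
    have h2 := norm_sub_norm_le 1 (c * (b (m + n) / b m * x (m + n)))
    rw [norm_sub_rev] at h2
    rw [← norm_div, ← norm_mul, ← norm_mul]
    rw [norm_one] at h2
    linarith
  have e2 : (T ^ n) x (m - n) = b m / b (m - n) * x m := by
    rw [hT, sub_add_cancel]
  rw [Finset.sum_singleton, one_mul, e2, norm_mul, norm_div]
  have hbn := hbpos (m - n)
  have hbm := hbpos m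
  have h3 : ‖b (m + n)‖ / C ≤ 1 / ‖b (m - n)‖ := by
    rw [div_le_div_iff₀ hC0 hbn]; linarith [hC n]
  calc 1 / 2 * ‖b m‖ ^ 2 * ‖x m‖ / C
      ≤ ‖c‖ * (‖b (m + n)‖ / ‖b m‖ * ‖x (m + n)‖) * ‖b m‖ ^ 2 * ‖x m‖ / C := by gcongr
    _ = ‖c‖ * ‖x (m + n)‖ * ‖b m‖ * ‖x m‖ * (‖b (m + n)‖ / C) := by field_simp
    _ ≤ ‖c‖ * ‖x (m + n)‖ * ‖b m‖ * ‖x m‖ * (1 / ‖b (m - n)‖) := by gcongr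
    _ = _ := by ring

/-! ### Weak hypercyclicity forces growth -/

/-- Double counting: `R` and its mirror image `R'` cover `s ×ˢ s`, so `R` has at least half of the
pairs, while its fibre over `n` injects into `P n`. -/
theorem exists_card_le_two_mul_card {Z : Set ℕ} {P : ℕ → Finset ℤ} {m : ℤ}
    (H : ∀ n ∈ Z, ∀ n' ∈ Z, m + n' - n ∈ P n ∨ m + n - n' ∈ P n') {s : Finset ℕ}
    (hs : s.Nonempty) (hsZ : ↑s ⊆ Z) : ∃ n ∈ s, s.card ≤ 2 * (P n).card := by
  classical
  by_contra! hlt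
  set R := (s ×ˢ s).filter fun a : ℕ × ℕ => m + a.2 - a.1 ∈ P a.1
  set R' := (s ×ˢ s).filter fun a : ℕ × ℕ => m + a.1 - a.2 ∈ P a.2
  have h1 : s ×ˢ s ⊆ R ∪ R' := fun a ha => by
    have ha' := Finset.mem_product.1 ha
    simp only [R, R', Finset.mem_union, Finset.mem_filter, ha, true_and]
    exact H _ (hsZ ha'.1) _ (hsZ ha'.2)
  have h2 : R.card ≤ ∑ n ∈ s, (P n).card := by
    rw [Finset.card_eq_sum_card_fiberwise (f := Prod.fst) (t := s) fun a ha =>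
      (Finset.mem_product.1 (Finset.mem_filter.1 ha).1).1]
    refine Finset.sum_le_sum fun n _ => ?_
    refine Finset.card_le_card_of_injOn (fun a => m + a.2 - a.1) ?_ ?_
    · rintro ⟨a, a'⟩ ha
      simp only [Finset.coe_filter, Finset.mem_filter, Set.mem_ofPred_eq] at ha
      obtain ⟨⟨-, h⟩, rfl⟩ := ha
      exact h
    · rintro ⟨a, a'⟩ ha ⟨c, c'⟩ hc h
      simp only [Finset.coe_filter, Set.mem_ofPred_eq] at ha hc
      obtain ⟨-, rfl⟩ := ha
      obtain ⟨-, rfl⟩ := hc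
      simp only at h
      simp only [Prod.mk.injEq, true_and]
      omega
  have h3 : R'.card = R.card := by
    refine Finset.card_bij' (fun a _ => a.swap) (fun a _ => a.swap) ?_ ?_ ?_ ?_ <;>
    simp [R, R'] <;> tauto
  have h4 := (Finset.card_le_card h1).trans (Finset.card_union_le _ _)
  rw [Finset.card_product, h3] at h4
  have h5 : ∑ n ∈ s, 2 * (P n).card < ∑ _n ∈ s, s.card := Finset.sum_lt_sum_of_nonempty hs hlt
  rw [← Finset.mul_sum, Finset.sum_const, smul_eq_mul] at h5
  omega

/-- Repeatedly remove an element whose `d` is at least the current cardinality; it is charged to the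
last term of the range. -/
theorem sum_le_sum_range_of_card_le {d : ℕ → ℕ} {Z : Set ℕ} {f : ℕ → ℝ}
    (hf : ∀ i j, 1 ≤ i → i ≤ j → f j ≤ f i)
    (H : ∀ s : Finset ℕ, s.Nonempty → ↑s ⊆ Z → ∃ n ∈ s, s.card ≤ d n) (N : ℕ) :
    ∀ s : Finset ℕ, ↑s ⊆ Z → s.card = N →
      ∑ n ∈ s, f (d n) ≤ ∑ k ∈ Finset.range N, f (k + 1) := by
  classical
  induction N with
  | zero => intro s _ hs; simp [Finset.card_eq_zero.1 hs]
  | succ N ih =>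
    intro s hsZ hs
    obtain ⟨n, hn, hd⟩ := H s (Finset.card_pos.1 (by omega)) hsZ
    rw [← Finset.add_sum_erase _ _ hn, Finset.sum_range_succ, add_comm]
    refine add_le_add (ih _ ?_ (by rw [Finset.card_erase_of_mem hn, hs]; rfl)) ?_
    · exact fun a ha => hsZ (Finset.mem_of_mem_erase ha)
    · rw [hs] at hd
      exact hf _ _ (by omega) hd

theorem lp.finite_setOf_le_norm {α : Type*} {p : ℝ≥0∞} [Fact (1 ≤ p)] (hp : p ≠ ∞)
    (x : ℓ^p(α, ℂ)) {ε : ℝ} (hε : 0 < ε) : {k | ε ≤ ‖x k‖}.Finite := by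
  have hp0 : 0 < p.toReal := ENNReal.toReal_pos (zero_lt_one.trans_le Fact.out).ne' hp
  have h1 := ((lp.memℓp x).summable hp0).tendsto_cofinite_zero
  have h2 := h1.eventually (gt_mem_nhds (Real.rpow_pos_of_pos hε p.toReal))
  refine (Filter.eventually_cofinite.1 h2).subset fun k hk => ?_
  simp only [Set.mem_ofPred_eq, not_lt] at hk ⊢
  gcongr

theorem exists_growth_of_weaklyHypercyclic {p : ℝ≥0∞} [Fact (1 ≤ p)] (hp2 : p < 2)
    {T : ℓ^p(ℤ, ℂ) →L[ℂ] ℓ^p(ℤ, ℂ)} {b : ℤ → ℂ} (hb : ∀ k, b k ≠ 0)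
    (hT : ∀ (n : ℕ) (x : ℓ^p(ℤ, ℂ)) (k : ℤ), (T ^ n) x k = b (k + n) / b k * x (k + n))
    (hwh : IsWeaklyHypercyclic T) (m : ℤ) (K : ℝ) :
    ∃ n : ℕ, K ≤ ‖b (m + n)‖ ∧ K ≤ ‖b (m - n)‖ := by
  classical
  by_contra! hK
  obtain ⟨x, hx⟩ := hwh
  have hptop : p ≠ ∞ := (hp2.trans ENNReal.ofNat_lt_top).ne
  have hbpos : ∀ k, 0 < ‖b k‖ := fun k => norm_pos_iff.2 (hb k)
  have hbm := hbpos m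
  have hK0 : 0 < K := by
    by_contra! h
    exact absurd (hK 0 (h.trans (norm_nonneg _))) (not_lt.2 (h.trans (norm_nonneg _)))
  -- The bound `r < 2` makes `k ^ (-(2 / r))` summable; `3 / 2 ≤ r` keeps the conjugate exponent at
  -- most `3`, even for `p` near `1`.
  obtain ⟨r, hr1, hr2, hpr⟩ : ∃ r : ℝ, 3 / 2 ≤ r ∧ r < 2 ∧ p ≤ ENNReal.ofReal r := by
    refine ⟨max (3 / 2) p.toReal, le_max_left _ _, max_lt (by norm_num) ?_, ?_⟩
    · simpa using (ENNReal.toReal_lt_toReal hptop (by norm_num)).2 hp2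
    · refine (ENNReal.ofReal_toReal hptop).ge.trans ?_
      exact ENNReal.ofReal_le_ofReal (le_max_right _ _)
  set q := r.conjExponent with hq
  have hrq : r.HolderConjugate q := Real.HolderConjugate.conjExponent (by linarith)
  have hq2 : 2 ≤ q := by
    rw [hq, Real.conjExponent, le_div_iff₀ (by linarith)]; linarith
  have hq4 : q ≤ 4 := by
    rw [hq, Real.conjExponent, div_le_iff₀ (by linarith)]; linarith
  have hr0 : 0 < r := by linarith
  have hq0 : 0 < q := by linarith
  set Z : Set ℕ := {n | ‖(T ^ n) x m - 1‖ < 1 / 2}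
  -- The first bound is the size forced where `‖b k‖ < K`; the second puts `m` itself in `P n` for
  -- `n ∈ Z`.
  set ε := min (‖b m‖ / 2 / K) (1 / 2) with hεdef
  have hε : 0 < ε := by positivity
  have hPfin : ∀ n : ℕ, {k | ε ≤ ‖(T ^ n) x k‖}.Finite := fun n =>
    lp.finite_setOf_le_norm hptop _ hε
  set P : ℕ → Finset ℤ := fun n => (hPfin n).toFinset
  have hP : ∀ n k, k ∈ P n ↔ ε ≤ ‖(T ^ n) x k‖ := fun n k => (hPfin n).mem_toFinset
  have hZ : ∀ n ∈ Z, 1 / 2 ≤ ‖(T ^ n) x m‖ := fun n hn => by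
    have h2 := norm_sub_norm_le 1 ((T ^ n) x m)
    rw [norm_sub_rev, norm_one] at h2
    have : ‖(T ^ n) x m - 1‖ < 1 / 2 := hn
    linarith
  have hZ' : ∀ n ∈ Z, ‖b m‖ / 2 ≤ ‖b (m + n) * x (m + n)‖ := fun n hn => by
    have h1 := hZ n hn
    rw [hT, div_mul_eq_mul_div, norm_div, le_div_iff₀ hbm] at h1
    linarith
  have hlarge : ∀ n ∈ Z, ∀ (j : ℕ) (k : ℤ), k + j = m + n → ‖b k‖ < K → k ∈ P j :=
    fun n hn j k hjk hk => by
      rw [hP, hT, hjk, div_mul_eq_mul_div, norm_div]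
      calc ε ≤ ‖b m‖ / 2 / K := min_le_left _ _
        _ ≤ _ := by
          have := hbpos k
          have := hZ' n hn
          gcongr
  -- With `d = n' - n`, one of `‖b (m + d)‖`, `‖b (m - d)‖` is below `K`, and dividing by it makes
  -- the corresponding orbit coordinate large.
  have hlt : ∀ n ∈ Z, ∀ n' ∈ Z, n ≤ n' → m + n' - n ∈ P n ∨ m + n - n' ∈ P n' := by
    intro n hn n' hn' hnn'
    by_cases h : K ≤ ‖b (m + (n' - n : ℕ))‖
    · have h1 := hK _ h
      rw [show m - ((n' - n : ℕ) : ℤ) = m + n - n' by omega] at h1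
      exact Or.inr (hlarge n hn n' _ (sub_add_cancel _ _) h1)
    · rw [show m + ((n' - n : ℕ) : ℤ) = m + n' - n by omega, not_le] at h
      exact Or.inl (hlarge n' hn' n _ (sub_add_cancel _ _) h)
  have H : ∀ n ∈ Z, ∀ n' ∈ Z, m + n' - n ∈ P n ∨ m + n - n' ∈ P n' := by
    intro n hn n' hn'
    rcases le_total n n' with h | h
    · exact hlt n hn n' hn' h
    · exact (hlt n' hn' n hn h).symm
  have hPpos : ∀ n ∈ Z, 0 < (P n).card := fun n hn =>
    Finset.card_pos.2 ⟨m, (hP n m).2 ((min_le_right _ _).trans (hZ n hn))⟩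
  set β : ℕ → ℝ := fun n => if n ∈ Z then ((2 * (P n).card : ℕ) : ℝ) ^ (-(1 / r)) else 0 with hβ
  have hβ0 : ∀ n, 0 ≤ β n := fun n => by simp only [hβ]; split_ifs <;> positivity
  have hsum : Summable fun n => β n ^ 2 := by
    have hs : Summable fun k : ℕ => ((k + 1 : ℕ) : ℝ) ^ (-(2 / r)) := by
      refine (summable_nat_add_iff (f := fun k : ℕ => (k : ℝ) ^ (-(2 / r))) 1).2 ?_
      rw [Real.summable_nat_rpow]
      have : 1 < 2 / r := by rw [lt_div_iff₀ hr0]; linarith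
      linarith
    refine summable_of_sum_le (fun n => sq_nonneg _)
      (c := ∑' k : ℕ, ((k + 1 : ℕ) : ℝ) ^ (-(2 / r))) fun u => ?_
    have h1 : ∑ n ∈ u, β n ^ 2
        = ∑ n ∈ u.filter (· ∈ Z), ((2 * (P n).card : ℕ) : ℝ) ^ (-(2 / r)) := by
      rw [Finset.sum_filter]
      refine Finset.sum_congr rfl fun n _ => ?_
      simp only [hβ]
      split_ifs
      · rw [← Real.rpow_natCast, ← Real.rpow_mul (by positivity)]
        congr 1; push_cast; ring
      · simp
    rw [h1]
    refine (sum_le_sum_range_of_card_le (d := fun n => 2 * (P n).card) (Z := Z)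
      (f := fun k => (k : ℝ) ^ (-(2 / r))) ?_ ?_ _ _ ?_ rfl).trans
      (hs.sum_le_tsum _ fun k _ => by positivity)
    · intro i j hi hij
      have hi' : (0 : ℝ) < i := by exact_mod_cast hi
      exact Real.rpow_le_rpow_of_nonpos hi' (by exact_mod_cast hij)
        (neg_nonpos.2 (by positivity))
    · exact fun s hs hsZ => exists_card_le_two_mul_card H hs hsZ
    · intro n hn
      exact (Finset.mem_filter.1 hn).2
  -- Conjugate phases on the `N` large coordinates, normalised in `ℓ_q`: the pairing is at least `N
  -- ^ (1 / r) * ε`, which cancels the weight `(2 * N) ^ (-(1 / r))`.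
  set h : ℕ → ℤ → ℂ := fun n k => (((P n).card : ℝ) ^ (-(1 / q)) : ℝ) *
    (starRingEnd ℂ ((T ^ n) x k) / ‖(T ^ n) x k‖) with hh
  have hynorm : ∀ n, ∀ k ∈ P n, 0 < ‖(T ^ n) x k‖ := fun n k hk => hε.trans_le ((hP n k).1 hk)
  refine lp.not_dense_of_plank (p := p) hq2 hq4 hrq hpr (i := m) (j := m + 1) (by omega)
    (fun n => (T ^ n) x) P h (fun n => ?_) β hβ0 hsum (ε := (2 : ℝ) ^ (-(1 / r)) * ε)
    (by positivity) ?_ hx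
  · have h1 : ∀ k ∈ P n, ‖h n k‖ ^ q = ((P n).card : ℝ)⁻¹ := fun k hk => by
      have h2 := hynorm n k hk
      rw [hh]
      simp only [norm_mul, norm_div, RCLike.norm_conj, Complex.norm_real, norm_norm]
      rw [div_self h2.ne', mul_one, Real.norm_of_nonneg (by positivity),
        ← Real.rpow_mul (by positivity), show -(1 / q) * q = -1 by field_simp, Real.rpow_neg_one]
    rw [Finset.sum_congr rfl h1, Finset.sum_const, nsmul_eq_mul]
    exact mul_inv_le_one
  · rintro _ ⟨n, rfl⟩ hn
    refine ⟨n, 1, (one_smul _ _).symm, ?_⟩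
    have hnZ : n ∈ Z := hn
    have hN : (0 : ℝ) < (P n).card := by exact_mod_cast hPpos n hnZ
    set N : ℝ := ((P n).card : ℝ)
    have h1 : ∑ k ∈ P n, h n k * (T ^ n) x k
        = ((N ^ (-(1 / q)) * ∑ k ∈ P n, ‖(T ^ n) x k‖ : ℝ) : ℂ) := by
      rw [Complex.ofReal_mul, Complex.ofReal_sum, Finset.mul_sum]
      refine Finset.sum_congr rfl fun k hk => ?_
      have h2 : ((‖(T ^ n) x k‖ : ℝ) : ℂ) ≠ 0 := by exact_mod_cast (hynorm n k hk).ne'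
      have h3 : starRingEnd ℂ ((T ^ n) x k) * (T ^ n) x k = (‖(T ^ n) x k‖ : ℂ) ^ 2 :=
        Complex.conj_mul' _
      simp only [hh]
      rw [mul_assoc, div_mul_eq_mul_div, h3, sq, mul_div_assoc, div_self h2, mul_one]
    have h2 : N * ε ≤ ∑ k ∈ P n, ‖(T ^ n) x k‖ := by
      rw [← nsmul_eq_mul]
      exact Finset.card_nsmul_le_sum _ _ _ fun k hk => (hP n k).1 hk
    rw [h1, Complex.norm_real, Real.norm_of_nonneg (by positivity), norm_one, one_mul]
    simp only [hβ, if_pos hnZ]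
    have h3 : ((2 * (P n).card : ℕ) : ℝ) ^ (-(1 / r)) = 2 ^ (-(1 / r)) * N ^ (-(1 / r)) := by
      rw [Nat.cast_mul, Real.mul_rpow (by positivity) (by positivity)]; rfl
    have h4 : N ^ (-(1 / r)) * (N ^ (-(1 / q)) * N) = 1 := by
      rw [← Real.rpow_add_one hN.ne', ← Real.rpow_add hN]
      have := hrq.inv_add_inv_eq_one
      rw [show -(1 / r) + (-(1 / q) + 1) = 0 by simp only [one_div]; linarith, Real.rpow_zero]
    rw [h3]
    calc (2 : ℝ) ^ (-(1 / r)) * ε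
        = 2 ^ (-(1 / r)) * (N ^ (-(1 / r)) * (N ^ (-(1 / q)) * N)) * ε := by rw [h4, mul_one]
      _ = 2 ^ (-(1 / r)) * N ^ (-(1 / r)) * (N ^ (-(1 / q)) * (N * ε)) := by ring
      _ ≤ _ := mul_le_mul_of_nonneg_left (mul_le_mul_of_nonneg_left h2
          (Real.rpow_nonneg hN.le _)) (mul_nonneg (by positivity) (Real.rpow_nonneg hN.le _))

/-! ### Growth suffices: topological transitivity -/

theorem exists_dense_range_apply_of_transitive {X I : Type*} [TopologicalSpace X] [BaireSpace X]
    [SecondCountableTopology X] [Nonempty X] (φ : I → X → X) (hφ : ∀ i, Continuous (φ i))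
    (h : ∀ U V : Set X, IsOpen U → U.Nonempty → IsOpen V → V.Nonempty →
      ∃ i, ∃ x ∈ U, φ i x ∈ V) : ∃ x, Dense (Set.range fun i => φ i x) := by
  have hB := TopologicalSpace.isBasis_countableBasis X
  have hd : Dense (⋂ V ∈ TopologicalSpace.countableBasis X, ⋃ i, φ i ⁻¹' V) := by
    refine dense_biInter_of_isOpen
      (fun V hV => isOpen_iUnion fun i => (hB.isOpen hV).preimage (hφ i))
      (TopologicalSpace.countable_countableBasis X) fun V hV => ?_
    refine dense_iff_inter_open.2 fun U hU hUne => ?_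
    obtain ⟨i, x, hxU, hxV⟩ := h U V hU hUne (hB.isOpen hV)
      (TopologicalSpace.nonempty_of_mem_countableBasis hV)
    exact ⟨x, hxU, Set.mem_iUnion.2 ⟨i, hxV⟩⟩
  obtain ⟨x, hx⟩ := hd.nonempty
  refine ⟨x, hB.dense_iff.2 fun V hV _ => ?_⟩
  obtain ⟨i, hi⟩ := Set.mem_iUnion.1 (Set.mem_iInter₂.1 hx V hV)
  exact ⟨φ i x, hi, i, rfl⟩

theorem lp.secondCountableTopology {α : Type*} [DecidableEq α] [Countable α] {p : ℝ≥0∞} [Fact (1 ≤ p)]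
    (hp : p ≠ ∞) : SecondCountableTopology ℓ^p(α, ℂ) := by
  suffices TopologicalSpace.SeparableSpace ℓ^p(α, ℂ) from
    UniformSpace.secondCountable_of_separable _
  rw [← TopologicalSpace.isSeparable_univ_iff]
  have h1 : TopologicalSpace.IsSeparable
      (Submodule.span ℂ (Set.range fun k : α => (lp.single p k (1 : ℂ) : ℓ^p(α, ℂ))) :
        Set ℓ^p(α, ℂ)) := (Set.countable_range _).isSeparable.span
  refine h1.closure.mono fun x _ => ?_
  refine mem_closure_of_tendsto (lp.hasSum_single hp x) (Filter.Eventually.of_forall fun s => ?_)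
  refine Submodule.sum_mem _ fun k _ => ?_
  have h3 : lp.single p k (x k) = x k • (lp.single p k (1 : ℂ) : ℓ^p(α, ℂ)) := by
    rw [← lp.single_smul, smul_eq_mul, mul_one]
  rw [h3]
  exact Submodule.smul_mem _ _ (Submodule.subset_span ⟨k, rfl⟩)

theorem lp.exists_sum_single_mem {α : Type*} [DecidableEq α] {p : ℝ≥0∞} [Fact (1 ≤ p)] (hp : p ≠ ∞)
    {U : Set ℓ^p(α, ℂ)} (hU : IsOpen U) (hne : U.Nonempty) :
    ∃ (s : Finset α) (a : α → ℂ), ∑ k ∈ s, (lp.single p k (a k) : ℓ^p(α, ℂ)) ∈ U := by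
  obtain ⟨x, hx⟩ := hne
  obtain ⟨s, hs⟩ := ((lp.hasSum_single hp x).eventually (hU.mem_nhds hx)).exists
  exact ⟨s, x, hs⟩

section WeightedShift

variable {p : ℝ≥0∞} [Fact (1 ≤ p)] {T : ℓ^p(ℤ, ℂ) →L[ℂ] ℓ^p(ℤ, ℂ)} {b : ℤ → ℂ} {M : ℝ}

theorem pow_apply_single
    (hT : ∀ (n : ℕ) (x : ℓ^p(ℤ, ℂ)) (k : ℤ), (T ^ n) x k = b (k + n) / b k * x (k + n))
    (n : ℕ) (j : ℤ) (a : ℂ) :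
    (T ^ n) (lp.single p j a) = lp.single p (j - n) (b j / b (j - n) * a) := by
  refine lp.ext (funext fun k => ?_)
  rw [hT, lp.single_apply, lp.single_apply]
  by_cases h : k = j - n
  · subst h; simp
  · have : k + n ≠ j := by omega
    simp [h, this]

/-- Take `m` above both supports. As `‖b‖` grows at most by the factor `M` per step to the right,
`‖b (m ± n)‖` is at most a constant times `‖b (k ± n)‖` for each `k` in a support, uniformly in `n`.
-/
theorem exists_preimage_and_bounds (hM : 1 ≤ M) (hb : ∀ k, b k ≠ 0)
    (hbM : ∀ k, ‖b (k + 1)‖ ≤ M * ‖b k‖)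
    (hT : ∀ (n : ℕ) (x : ℓ^p(ℤ, ℂ)) (k : ℤ), (T ^ n) x k = b (k + n) / b k * x (k + n))
    (s s' : Finset ℤ) (a a' : ℤ → ℂ) :
    ∃ (m : ℤ) (A : ℝ), 0 ≤ A ∧ ∀ n : ℕ,
      ‖(T ^ n) (∑ k ∈ s, (lp.single p k (a k) : ℓ^p(ℤ, ℂ)))‖ * ‖b (m - n)‖ ≤ A ∧
      ∃ z : ℓ^p(ℤ, ℂ), (T ^ n) z = ∑ k ∈ s', (lp.single p k (a' k) : ℓ^p(ℤ, ℂ)) ∧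
        ‖z‖ * ‖b (m + n)‖ ≤ A := by
  have hp0 : 0 < p := zero_lt_one.trans_le Fact.out
  have hbpos : ∀ k, 0 < ‖b k‖ := fun k => norm_pos_iff.2 (hb k)
  obtain ⟨m, hm⟩ := (s ∪ s').bddAbove
  set B : Finset ℤ → (ℤ → ℂ) → ℝ := fun s a => ∑ k ∈ s, ‖b k‖ * ‖a k‖ * M ^ (m - k).toNat
  have hB0 : ∀ s a, 0 ≤ B s a := fun s a => Finset.sum_nonneg fun k _ => by positivity
  have hsum : ∀ (s : Finset ℤ) (a : ℤ → ℂ) (d : ℤ), (∀ k ∈ s, k ≤ m) →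
      ‖∑ k ∈ s, (lp.single p (k + d) (b k / b (k + d) * a k) : ℓ^p(ℤ, ℂ))‖ * ‖b (m + d)‖
        ≤ B s a := fun s a d hs => by
    refine (mul_le_mul_of_nonneg_right (norm_sum_le _ _) (norm_nonneg _)).trans ?_
    rw [Finset.sum_mul]
    refine Finset.sum_le_sum fun k hk => ?_
    rw [lp.norm_single hp0, norm_mul, norm_div]
    have h1 := norm_le_pow_mul_norm hM hbM (k + d) (m - k).toNat
    rw [Int.toNat_of_nonneg (by linarith [hs k hk]), show k + d + (m - k) = m + d by ring] at h1
    have h2 := hbpos (k + d)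
    calc ‖b k‖ / ‖b (k + d)‖ * ‖a k‖ * ‖b (m + d)‖
        ≤ ‖b k‖ / ‖b (k + d)‖ * ‖a k‖ * (M ^ (m - k).toNat * ‖b (k + d)‖) := by gcongr
      _ = _ := by field_simp
  refine ⟨m, max (B s a) (B s' a'), le_max_of_le_left (hB0 _ _), fun n => ⟨?_, ?_⟩⟩
  · have h1 := hsum s a (-n) fun k hk => hm (Finset.mem_coe.2 (Finset.mem_union_left _ hk))
    simp only [← sub_eq_add_neg] at h1
    rw [map_sum]
    simp only [pow_apply_single hT]
    exact h1.trans (le_max_left _ _)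
  · refine ⟨_, ?_, (hsum s' a' n fun k hk =>
      hm (Finset.mem_coe.2 (Finset.mem_union_right _ hk))).trans (le_max_right _ _)⟩
    rw [map_sum]
    refine Finset.sum_congr rfl fun k _ => ?_
    rw [pow_apply_single hT, add_sub_cancel_right]
    congr 1
    have h1 := hb k
    have h2 := hb (k + n)
    field_simp

theorem isHypercyclic_of_growth (hp : p ≠ ∞) (hM : 1 ≤ M) (hb : ∀ k, b k ≠ 0)
    (hbM : ∀ k, ‖b (k + 1)‖ ≤ M * ‖b k‖)
    (hT : ∀ (n : ℕ) (x : ℓ^p(ℤ, ℂ)) (k : ℤ), (T ^ n) x k = b (k + n) / b k * x (k + n))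
    (h : ∀ (m : ℤ) (K : ℝ), ∃ n : ℕ, K ≤ ‖b (m + n)‖ ∧ K ≤ ‖b (m - n)‖) : IsHypercyclic T := by
  have := lp.secondCountableTopology (α := ℤ) hp
  obtain ⟨x, hx⟩ := exists_dense_range_apply_of_transitive (fun n : ℕ => ⇑(T ^ n))
    (fun n => (T ^ n).continuous) fun U V hU hUne hV hVne => by
      obtain ⟨s, a, hu⟩ := lp.exists_sum_single_mem hp hU hUne
      obtain ⟨s', a', hv⟩ := lp.exists_sum_single_mem hp hV hVne
      obtain ⟨m, A, hA, hmA⟩ := exists_preimage_and_bounds hM hb hbM hT s s' a a'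
      obtain ⟨ε, hε, hεU⟩ := Metric.isOpen_iff.1 hU _ hu
      obtain ⟨ε', hε', hεV⟩ := Metric.isOpen_iff.1 hV _ hv
      set δ := min ε ε'
      have hδ : 0 < δ := lt_min hε hε'
      obtain ⟨n, hn1, hn2⟩ := h m ((A + 1) / δ)
      obtain ⟨h1, z, hz, h2⟩ := hmA n
      have hsmall : ∀ t c : ℝ, 0 ≤ t → t * c ≤ A → (A + 1) / δ ≤ c → t < δ := fun t c ht htc hc => by
        rw [div_le_iff₀ hδ] at hc
        by_contra! hlt
        have : 0 < c := by
          by_contra! h0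
          nlinarith
        nlinarith
      refine ⟨n, _, hεU (a := ∑ k ∈ s, lp.single p k (a k) + z) ?_, ?_⟩
      · rw [mem_ball_iff_norm, add_sub_cancel_left]
        exact (hsmall _ _ (norm_nonneg _) h2 hn1).trans_le (min_le_left _ _)
      · refine hεV ?_
        rw [map_add, hz, mem_ball_iff_norm, add_sub_cancel_right]
        exact (hsmall _ _ (norm_nonneg _) h1 hn2).trans_le (min_le_right _ _)
  refine ⟨x, hx.mono ?_⟩
  rintro _ ⟨n, rfl⟩
  exact ⟨n, rfl⟩

theorem isSupercyclic_of_growth (hp : p ≠ ∞) (hM : 1 ≤ M) (hb : ∀ k, b k ≠ 0)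
    (hbM : ∀ k, ‖b (k + 1)‖ ≤ M * ‖b k‖)
    (hT : ∀ (n : ℕ) (x : ℓ^p(ℤ, ℂ)) (k : ℤ), (T ^ n) x k = b (k + n) / b k * x (k + n))
    (h : ∀ (m : ℤ) (K : ℝ), ∃ n : ℕ, K ≤ ‖b (m + n)‖ * ‖b (m - n)‖) : IsSupercyclic T := by
  have := lp.secondCountableTopology (α := ℤ) hp
  obtain ⟨x, hx⟩ := exists_dense_range_apply_of_transitive
    (fun i : ℕ × ℂ => fun x => i.2 • (T ^ i.1) x)
    (fun i => (T ^ i.1).continuous.const_smul i.2) fun U V hU hUne hV hVne => by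
      obtain ⟨s, a, hu⟩ := lp.exists_sum_single_mem hp hU hUne
      obtain ⟨s', a', hv⟩ := lp.exists_sum_single_mem hp hV hVne
      obtain ⟨m, A, hA, hmA⟩ := exists_preimage_and_bounds hM hb hbM hT s s' a a'
      obtain ⟨ε, hε, hεU⟩ := Metric.isOpen_iff.1 hU _ hu
      obtain ⟨ε', hε', hεV⟩ := Metric.isOpen_iff.1 hV _ hv
      obtain ⟨n, hn⟩ := h m ((A ^ 2 + 1) / (ε * ε'))
      obtain ⟨h1, z, hz, h2⟩ := hmA n
      set u : ℓ^p(ℤ, ℂ) := ∑ k ∈ s, lp.single p k (a k)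
      have hprod : ‖(T ^ n) u‖ * ‖z‖ < ε * ε' := by
        rw [div_le_iff₀ (by positivity)] at hn
        have h3 := mul_le_mul h1 h2 (by positivity) hA
        by_contra! hlt
        have h4 : ε * ε' * (‖b (m + n)‖ * ‖b (m - n)‖)
            ≤ ‖(T ^ n) u‖ * ‖z‖ * (‖b (m + n)‖ * ‖b (m - n)‖) := by gcongr
        nlinarith
      -- The vector `u + t • z` must be near `u`, and its image divided by `t` near `(T ^ n) z`;
      -- such a `t` exists because the product of the two norms is below `ε * ε'`.
      obtain ⟨t, ht0, ht1, ht2⟩ : ∃ t : ℝ, 0 < t ∧ ‖(T ^ n) u‖ < ε' * t ∧ t * ‖z‖ < ε := by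
        rcases (norm_nonneg z).eq_or_lt with hz0 | hz0
        · refine ⟨‖(T ^ n) u‖ / ε' + 1, by positivity, ?_, by rw [← hz0, mul_zero]; exact hε⟩
          rw [mul_add, mul_div_cancel₀ _ hε'.ne']; linarith
        · obtain ⟨t, h3, h4⟩ := exists_between (show ‖(T ^ n) u‖ / ε' < ε / ‖z‖ by
            rw [div_lt_div_iff₀ hε' hz0]; exact hprod)
          refine ⟨t, (by positivity : 0 ≤ ‖(T ^ n) u‖ / ε').trans_lt h3, ?_, ?_⟩
          · rw [div_lt_iff₀ hε'] at h3; linarith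
          · rwa [lt_div_iff₀ hz0] at h4
      have htC : (t : ℂ) ≠ 0 := by exact_mod_cast ht0.ne'
      refine ⟨(n, (t : ℂ)⁻¹), _, hεU (a := u + (t : ℂ) • z) ?_, ?_⟩
      · rw [mem_ball_iff_norm, add_sub_cancel_left, norm_smul, Complex.norm_real,
          Real.norm_of_nonneg ht0.le]
        exact ht2
      · refine hεV ?_
        simp only
        rw [map_add, map_smul, hz, smul_add, inv_smul_smul₀ htC, mem_ball_iff_norm,
          add_sub_cancel_right, norm_smul, norm_inv, Complex.norm_real,
          Real.norm_of_nonneg ht0.le, inv_mul_lt_iff₀ ht0]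
        linarith
  refine ⟨x, hx.mono ?_⟩
  rintro _ ⟨⟨n, c⟩, rfl⟩
  exact ⟨n, c, rfl⟩

end WeightedShift

theorem theorem1p6 (p : ℝ≥0∞) [Fact (1 ≤ p)] (T : ℓ^p(ℤ, ℂ) →L[ℂ] ℓ^p(ℤ, ℂ))
    (hT : IsBilateralWeightedShift T) :
    (p < 2 → IsWeaklyHypercyclic T → IsHypercyclic T) ∧
      (p ≤ 2 → IsWeaklySupercyclic T → IsSupercyclic T) := by
  refine ⟨fun hp h => ?_, fun hp h => ?_⟩
  · have hp' : p ≠ ∞ := (hp.trans ENNReal.ofNat_lt_top).ne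
    obtain ⟨b, M, hM, hb, hbM, hTb⟩ := hT.exists_weights hp'
    exact isHypercyclic_of_growth hp' hM hb hbM hTb
      (exists_growth_of_weaklyHypercyclic hp hb hTb h)
  · have hp' : p ≠ ∞ := (hp.trans_lt ENNReal.ofNat_lt_top).ne
    obtain ⟨b, M, hM, hb, hbM, hTb⟩ := hT.exists_weights hp'
    exact isSupercyclic_of_growth hp' hM hb hbM hTb
      (exists_growth_of_weaklySupercyclic hp hM hb hbM hTb h)
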